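/- Let $T>0$ and let $X=(X_t)_{t\in[0,T]}$ be a centered real Gaussian process on a probability space $(\Omega,\mathcal F,\mathbb P)$ with $\sup_{t\in[0,T]}\mathbb E[X_t^2]<\infty$. Suppose that there are a standard Brownian motion $W=(W_t)_{t\in[0,T]}$ on the same probability space and a deterministic kernel $K\in L^2([0,T]^2)$, with $K(t,\cdot)\in L^2([0,T])$ for every $t\in[0,T]$, such that for every $t\in[0,T]$ $$X_t=\int_0^T K(t,s)\,dW_s\qquad\text{almost surely}$$ (Wiener integral). Suppose moreover that $H^X_T=H^W_T$, where $H^X_T$ and $H^W_T$ denote the closures in $L^2(\Omega)$ of the linear spans of $\{X_s:s\in[0,T]\}$ and of $\{W_s:s\in[0,T]\}$. Let $\Delta=\bigcup_{k=1}^n[t_L^k,t_U^k]$ with $0\le t_L^1<t_U^1<t_L^2<t_U^2<\dots<t_L^n<t_U^n\le T$, and let $\mathcal F_\Delta=\sigma(X_u:u\in\Delta)$. Let $t\in[0,T]\setminus\Delta$. Then there is exactly one $f_t\in L^2([0,T])$ that satisfies both 1. $\displaystyle\int_0^T f_t(s)K(u,s)\,ds=\int_0^T K(t,s)K(u,s)\,ds$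 for all $u\in\Delta$, and 2. $\displaystyle\int_0^T f_t(s)g(s)\,ds=0$ for every $g\in L^2([0,T])$ such that $\displaystyle\int_0^T g(s)K(u,s)\,ds=0$ for all $u\in\Delta$; and this $f_t$ satisfies $$\mathbb E[X_t\mid\mathcal F_\Delta]=\int_0^T f_t(s)\,dW_s\qquad\text{almost surely.}$$ -/

import Mathlib

open MeasureTheory ProbabilityTheory
open scoped ENNReal

noncomputable section

/-- A standard Brownian motion on the compact time interval `[0, T]`: a centered Gaussian process
with covariance `E[W_s W_t] = min s t` and almost surely continuous paths. -/
structure IsBrownianOn {Ω : Type*} [MeasurableSpace Ω] (P : Measure Ω) {T : ℝ}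
    (W : Set.Icc (0 : ℝ) T → Ω → ℝ) : Prop where
  gaussian : IsGaussianProcess W P
  centered : ∀ t, ∫ ω, W t ω ∂P = 0
  cov : ∀ s t, ∫ ω, W s ω * W t ω ∂P = min (s : ℝ) (t : ℝ)
  cont : ∀ᵐ ω ∂P, Continuous (fun t => W t ω)

/-- The first chaos of `X`: the closure in `L²(Ω)` of the linear span of the (classes of the)
random variables `X t`, with `t` in the whole index set. -/
def firstChaos {Ω ι : Type*} [MeasurableSpace Ω] (P : Measure Ω) (X : ι → Ω → ℝ) :
    Submodule ℝ (Lp ℝ 2 P) :=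
  (Submodule.span ℝ {ξ : Lp ℝ 2 P | ∃ t, ξ =ᵐ[P] X t}).topologicalClosure

/-- The `σ`-algebra `σ(X_t : t ∈ Δ)`. -/
abbrev sigmaOn {Ω ι : Type*} (X : ι → Ω → ℝ) (Δ : Set ι) : MeasurableSpace Ω :=
  ⨆ t ∈ Δ, MeasurableSpace.comap (X t) inferInstance

/-- The union of the closed intervals `[a k, b k]`. -/
def unionIcc {T : ℝ} {n : ℕ} (a b : Fin n → Set.Icc (0 : ℝ) T) : Set (Set.Icc (0 : ℝ) T) :=
  ⋃ k, Set.Icc (a k) (b k)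

/-- Lebesgue measure on the interval `[0, T]`. -/
abbrev leb (T : ℝ) : Measure (Set.Icc (0 : ℝ) T) := (volume : Measure ℝ).comap Subtype.val

/-- The Hilbert space `L²([0, T])`. -/
abbrev L2Icc (T : ℝ) : Type := Lp ℝ 2 (leb T)

theorem leb_Iic {T : ℝ} (t : Set.Icc (0 : ℝ) T) :
    leb T (Set.Iic t) = ENNReal.ofReal (t : ℝ) := by
  rw [(MeasurableEmbedding.subtype_coe measurableSet_Icc).comap_apply]
  have : (Subtype.val '' (Set.Iic t) : Set ℝ) = Set.Icc 0 (t : ℝ) := by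
    ext x
    constructor
    · rintro ⟨y, hy, rfl⟩
      exact ⟨y.2.1, hy⟩
    · rintro ⟨h0, h1⟩
      exact ⟨⟨x, h0, h1.trans t.2.2⟩, h1, rfl⟩
  rw [this, Real.volume_Icc, sub_zero]

/-- The step function `∑ cᵢ 1_{[0, tᵢ]}` in `L²([0, T])`, where `c = ∑ cᵢ δ_{tᵢ}`. -/
def stepFun (T : ℝ) :
    (Set.Icc (0 : ℝ) T →₀ ℝ) →ₗ[ℝ] L2Icc T :=
  Finsupp.linearCombination ℝ (fun t =>
    indicatorConstLp 2 (measurableSet_Iic (a := t))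
      (by rw [leb_Iic]; exact ENNReal.ofReal_ne_top) (1 : ℝ))

section Wiener

variable {Ω : Type*} [MeasurableSpace Ω] {P : Measure Ω} {T : ℝ} {W : Set.Icc (0 : ℝ) T → Ω → ℝ}

/-- The random variable `∑ cᵢ W_{tᵢ}` in `L²(Ω)`, where `c = ∑ cᵢ δ_{tᵢ}`. -/
def stepIntegral (hW : IsBrownianOn P W) : (Set.Icc (0 : ℝ) T →₀ ℝ) →ₗ[ℝ] Lp ℝ 2 P :=
  Finsupp.linearCombination ℝ (fun t => (hW.gaussian.hasGaussianLaw_eval t).memLp_two.toLp (W t))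

/-- The Wiener integral `f ↦ ∫₀ᵀ f(s) dW_s`: the continuous linear extension to `L²([0, T])` of
the map `∑ cᵢ 1_{[0, tᵢ]} ↦ ∑ cᵢ W_{tᵢ}` on step functions. The lemmas `wienerIntegral_stepFun`
and `norm_wienerIntegral` show that it is indeed an extension, and an isometry. -/
def wienerIntegral (hW : IsBrownianOn P W) :
    L2Icc T →L[ℝ] Lp ℝ 2 P :=
  (stepIntegral hW).extendOfNorm (stepFun T)

theorem inner_stepIntegral (hW : IsBrownianOn P W) (c d : Set.Icc (0 : ℝ) T →₀ ℝ) :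
    inner ℝ (stepIntegral hW c) (stepIntegral hW d) = inner ℝ (stepFun T c) (stepFun T d) := by
  simp only [stepIntegral, stepFun, Finsupp.linearCombination_apply, Finsupp.sum_inner,
    Finsupp.inner_sum]
  refine Finsupp.sum_congr fun s _ => Finsupp.sum_congr fun t _ => ?_
  simp only [inner_smul_left, inner_smul_right]
  congr 2
  have hfin : ∀ u : Set.Icc (0 : ℝ) T, leb T (Set.Iic u) ≠ ∞ := fun u => by
    rw [leb_Iic]
    exact ENNReal.ofReal_ne_top
  rw [L2.inner_indicatorConstLp_indicatorConstLp (hμs := hfin _) (hμt := hfin _), L2.inner_def]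
  have h1 : ∫ ω, inner ℝ (((hW.gaussian.hasGaussianLaw_eval t).memLp_two.toLp (W t)) ω)
      (((hW.gaussian.hasGaussianLaw_eval s).memLp_two.toLp (W s)) ω) ∂P
      = ∫ ω, W s ω * W t ω ∂P := by
    refine integral_congr_ae ?_
    filter_upwards [(hW.gaussian.hasGaussianLaw_eval t).memLp_two.coeFn_toLp,
      (hW.gaussian.hasGaussianLaw_eval s).memLp_two.coeFn_toLp] with ω ht hs
    rw [hs, ht]
    simp
  have h2 : (leb T).real (Set.Iic s ∩ Set.Iic t) = min (s : ℝ) (t : ℝ) := by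
    rw [Set.Iic_inter_Iic, measureReal_def, leb_Iic, ENNReal.toReal_ofReal (s ⊓ t).2.1]
    exact (Subtype.mono_coe _).map_min
  rw [h1, Set.inter_comm, h2, hW.cov]
  simp

theorem denseRange_stepFun (T : ℝ) : DenseRange (stepFun T) := by
  have hfin : IsFiniteMeasure (leb T) := ⟨by
    rw [(MeasurableEmbedding.subtype_coe measurableSet_Icc).comap_apply]
    refine (measure_mono (t := Set.Icc 0 T) ?_).trans_lt measure_Icc_lt_top
    rintro _ ⟨x, -, rfl⟩
    exact x.2⟩
  have hperp : (LinearMap.range (stepFun T))ᗮ = ⊥ := by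
    rw [Submodule.eq_bot_iff]
    intro f hf
    have hint : Integrable f (leb T) := (Lp.memLp f).integrable (by norm_num)
    have hIic : ∀ t, ∫ x in Set.Iic t, f x ∂(leb T) = 0 := by
      intro t
      have h := (Submodule.mem_orthogonal _ _).1 hf (stepFun T (Finsupp.single t 1)) ⟨_, rfl⟩
      rw [stepFun, Finsupp.linearCombination_single, one_smul,
        L2.inner_indicatorConstLp_one] at h
      exact h
    have huniv : ∫ x, f x ∂(leb T) = 0 := by
      by_cases hT : 0 ≤ T
      · have h := hIic ⟨T, hT, le_rfl⟩
        rwa [show Set.Iic (⟨T, hT, le_rfl⟩ : Set.Icc (0 : ℝ) T) = Set.univ from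
          Set.eq_univ_of_forall fun x => x.2.2, setIntegral_univ] at h
      · have : IsEmpty (Set.Icc (0 : ℝ) T) := ⟨fun x => hT (x.2.1.trans x.2.2)⟩
        exact integral_of_isEmpty
    have hall : ∀ s, MeasurableSet s → ∫ x in s, f x ∂(leb T) = 0 := by
      refine MeasurableSpace.induction_on_inter
        (C := fun s _ => ∫ x in s, f x ∂(leb T) = 0)
        ((BorelSpace.measurable_eq).trans (borel_eq_generateFrom_Iic _)) isPiSystem_Iic ?_ ?_ ?_ ?_
      · simp
      · rintro _ ⟨t, rfl⟩
        exact hIic t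
      · intro s hs h
        have := integral_add_compl hs hint
        linarith
      · intro s hd hs h
        rw [integral_iUnion hs hd hint.integrableOn]
        simp [h]
    exact (Lp.eq_zero_iff_ae_eq_zero).2 (hint.ae_eq_zero_of_forall_setIntegral_eq_zero
      fun s hs _ => hall s hs)
  have h := (Submodule.topologicalClosure_eq_top_iff (K := LinearMap.range (stepFun T))).2 hperp
  rw [Submodule.dense_iff_topologicalClosure_eq_top.symm] at h
  rwa [LinearMap.coe_range] at h

theorem wienerIntegral_stepFun (hW : IsBrownianOn P W) (c : Set.Icc (0 : ℝ) T →₀ ℝ) :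
    wienerIntegral hW (stepFun T c) = stepIntegral hW c :=
  LinearMap.extendOfNorm_eq (denseRange_stepFun T) ⟨1, fun x => by
    rw [one_mul, norm_eq_sqrt_real_inner, norm_eq_sqrt_real_inner, inner_stepIntegral]⟩ c

theorem norm_wienerIntegral (hW : IsBrownianOn P W)
    (f : L2Icc T) : ‖wienerIntegral hW f‖ = ‖f‖ := by
  refine (denseRange_stepFun T).induction (P := fun f => ‖wienerIntegral hW f‖ = ‖f‖) ?_
    (isClosed_eq (by fun_prop) (by fun_prop)) f
  rintro _ ⟨c, rfl⟩
  rw [wienerIntegral_stepFun, norm_eq_sqrt_real_inner, norm_eq_sqrt_real_inner, inner_stepIntegral]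

end Wiener

/-- `f ∈ L²([0, T])` solves the system of integral equations of the first kind
`∫ f(s) K(u, s) ds = ∫ K(t, s) K(u, s) ds`, `u ∈ Δ`, and is orthogonal in `L²([0, T])` to every `g`
such that `∫ g(s) K(u, s) ds = 0` for all `u ∈ Δ`. -/
structure IsFredholmSolution {T : ℝ} (K : Set.Icc (0 : ℝ) T → Set.Icc (0 : ℝ) T → ℝ)
    (Δ : Set (Set.Icc (0 : ℝ) T)) (t : Set.Icc (0 : ℝ) T) (f : L2Icc T) : Prop where
  system : ∀ u ∈ Δ, ∫ s, f s * K u s ∂(leb T) = ∫ s, K t s * K u s ∂(leb T)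
  orthogonal : ∀ g : L2Icc T, (∀ u ∈ Δ, ∫ s, g s * K u s ∂(leb T) = 0) →
    ∫ s, f s * g s ∂(leb T) = 0

end

/-! ### Characteristic functions under L² limits -/

section GaussianLimits

variable {Ω : Type*} [MeasurableSpace Ω] {P : Measure Ω}

/-! The Wiener integral is a linear isometry into `L²(Ω)` with jointly Gaussian values, so
predicting `X t` reduces to projecting `K t` orthogonally onto the closed span `M` of the sections
`K u`, `u ∈ Δ`. The integral equations say that `K t - f` is orthogonal to `M`, and the
orthogonality condition says that `f` lies in the double orthogonal complement of `M`, which is `M`.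
Together they characterise the projection (`isFredholmSolution_iff`), whence existence and
uniqueness.

For the prediction formula, split `X t` into the integrals of `f` and of `K t - f`. The former is an
L² limit of combinations of the `X u`, hence measurable for the observed σ-algebra up to null sets.
The latter is centered and uncorrelated with every `X u`, hence independent of them by joint
Gaussianity, so its conditional expectation vanishes. Joint Gaussianity passes from `W` to all
Wiener integrals by density of step functions. -/

theorem integral_norm_le_norm_L2 [IsProbabilityMeasure P] (F : Lp ℝ 2 P) :
    ∫ ω, ‖F ω‖ ∂P ≤ ‖F‖ := by
  rw [integral_norm_eq_lintegral_enorm (Lp.aestronglyMeasurable F), Lp.norm_def,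
    ← eLpNorm_one_eq_lintegral_enorm]
  exact ENNReal.toReal_mono (Lp.eLpNorm_ne_top F)
    (eLpNorm_le_eLpNorm_of_exponent_le (by norm_num) (Lp.aestronglyMeasurable F))

theorem norm_cexp_ofReal_mul_I_sub_le (x y : ℝ) :
    ‖Complex.exp (x * Complex.I) - Complex.exp (y * Complex.I)‖ ≤ ‖x - y‖ := by
  have h : Complex.exp (x * Complex.I) - Complex.exp (y * Complex.I)
      = Complex.exp (y * Complex.I) * (Complex.exp (Complex.I * ((x - y : ℝ) : ℂ)) - 1) := by
    rw [mul_sub, mul_one, ← Complex.exp_add]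
    congr 2
    push_cast
    ring
  rw [h, norm_mul, Complex.norm_exp_ofReal_mul_I, one_mul]
  exact Real.norm_exp_I_mul_ofReal_sub_one_le

theorem integrable_cexp_mul_I [IsFiniteMeasure P] {F : Ω → ℝ} (hF : AEStronglyMeasurable F P) :
    Integrable (fun ω => Complex.exp (F ω * Complex.I)) P := by
  refine Integrable.of_bound (C := 1) ?_ (.of_forall fun ω => ?_)
  · exact (by fun_prop : Continuous fun x : ℝ => Complex.exp (x * Complex.I)).comp_aestronglyMeasurable hF
  · rw [Complex.norm_exp_ofReal_mul_I]

/-- The L² norm dominates the L¹ norm on a probability space, and `x ↦ exp (i x)` is 1-Lipschitz.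
Frequency 1 suffices, since other frequencies arise by rescaling `F`. -/
theorem continuous_integral_cexp_mul_I [IsProbabilityMeasure P] :
    Continuous fun F : Lp ℝ 2 P => ∫ ω, Complex.exp (F ω * Complex.I) ∂P := by
  refine (LipschitzWith.of_dist_le_mul (K := 1) fun F G => ?_).continuous
  rw [NNReal.coe_one, one_mul, dist_eq_norm, dist_eq_norm,
    ← integral_sub (integrable_cexp_mul_I (Lp.aestronglyMeasurable F))
      (integrable_cexp_mul_I (Lp.aestronglyMeasurable G))]
  refine le_trans ?_ (integral_norm_le_norm_L2 (F - G))
  refine norm_integral_le_of_norm_le ((Lp.memLp (F - G)).integrable (by norm_num)).norm ?_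
  filter_upwards [Lp.coeFn_sub F G] with ω h
  rw [h]
  exact norm_cexp_ofReal_mul_I_sub_le _ _

end GaussianLimits

/-! ### Joint Gaussianity of Wiener integrals -/

section WienerLaw

variable {Ω : Type*} [MeasurableSpace Ω] {P : Measure Ω} {T : ℝ} {W : Set.Icc (0 : ℝ) T → Ω → ℝ}

theorem stepIntegral_ae_eq (hW : IsBrownianOn P W) (c : Set.Icc (0 : ℝ) T →₀ ℝ) :
    stepIntegral hW c =ᵐ[P] ∑ t ∈ c.support, fun ω => c t • W t ω := by
  classical
  rw [stepIntegral, Finsupp.linearCombination_apply, Finsupp.sum]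
  induction c.support using Finset.induction_on with
  | empty => simpa using Lp.coeFn_zero ℝ 2 P
  | insert t s ht ih =>
    rw [Finset.sum_insert ht, Finset.sum_insert ht]
    filter_upwards [ih, Lp.coeFn_add (c t • (hW.gaussian.hasGaussianLaw_eval t).memLp_two.toLp (W t))
      (∑ t ∈ s, c t • (hW.gaussian.hasGaussianLaw_eval t).memLp_two.toLp (W t)),
      Lp.coeFn_smul (c t) ((hW.gaussian.hasGaussianLaw_eval t).memLp_two.toLp (W t)),
      (hW.gaussian.hasGaussianLaw_eval t).memLp_two.coeFn_toLp] with ω h1 h2 h3 h4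
    rw [h2, Pi.add_apply, Pi.add_apply, h1, h3, Pi.smul_apply, h4]

theorem integral_mul_wienerIntegral (hW : IsBrownianOn P W) (f g : L2Icc T) :
    ∫ ω, wienerIntegral hW f ω * wienerIntegral hW g ω ∂P = inner ℝ f g := by
  have h := LinearIsometry.inner_map_map
    ⟨(wienerIntegral hW).toLinearMap, norm_wienerIntegral hW⟩ f g
  rw [← h, L2.inner_def]
  exact integral_congr_ae (.of_forall fun ω => mul_comm _ _)

theorem map_stepIntegral (hW : IsBrownianOn P W) (c : Set.Icc (0 : ℝ) T →₀ ℝ) :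
    P.map (stepIntegral hW c) = gaussianReal 0 (‖stepFun T c‖ ^ 2).toNNReal := by
  have hlaw : HasGaussianLaw (stepIntegral hW c) P :=
    ((hW.gaussian.smul c).hasGaussianLaw_sum (I := c.support)).congr (stepIntegral_ae_eq hW c).symm
  have hmean : ∫ ω, stepIntegral hW c ω ∂P = 0 := by
    rw [integral_congr_ae (stepIntegral_ae_eq hW c)]
    simp only [Finset.sum_apply]
    rw [integral_finsetSum (f := fun t ω => c t • W t ω) _ fun t _ => (hW.gaussian.hasGaussianLaw_eval t).integrable.smul (c t)]
    simp [integral_const_mul, hW.centered]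
  rw [hlaw.map_eq_gaussianReal, hmean, variance_of_integral_eq_zero hlaw.aemeasurable hmean,
    ← real_inner_self_eq_norm_sq, ← integral_mul_wienerIntegral hW, wienerIntegral_stepFun]
  simp [sq]

/-- Both sides are continuous in `f`, so the Gaussian law for step functions settles the general
case. -/
theorem integral_cexp_wienerIntegral [IsProbabilityMeasure P] (hW : IsBrownianOn P W)
    (f : L2Icc T) :
    ∫ ω, Complex.exp (wienerIntegral hW f ω * Complex.I) ∂P
      = Complex.exp (-(((‖f‖ ^ 2 : ℝ) : ℂ) / 2)) := by
  refine (denseRange_stepFun T).induction (P := fun f =>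
    ∫ ω, Complex.exp (wienerIntegral hW f ω * Complex.I) ∂P
      = Complex.exp (-(((‖f‖ ^ 2 : ℝ) : ℂ) / 2))) ?_
    (isClosed_eq (continuous_integral_cexp_mul_I.comp (wienerIntegral hW).continuous)
      (by fun_prop)) f
  rintro _ ⟨c, rfl⟩
  have h := charFun_gaussianReal (μ := 0) (v := (‖stepFun T c‖ ^ 2).toNNReal) 1
  rw [← map_stepIntegral hW c, charFun_apply_real,
    integral_map (Lp.aestronglyMeasurable _).aemeasurable (by fun_prop)] at h
  rw [wienerIntegral_stepFun]
  simpa [Real.coe_toNNReal _ (sq_nonneg _), neg_div] using h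

theorem map_wienerIntegral [IsProbabilityMeasure P] (hW : IsBrownianOn P W) (f : L2Icc T) :
    P.map (wienerIntegral hW f) = gaussianReal 0 (‖f‖ ^ 2).toNNReal := by
  have hm : AEMeasurable (wienerIntegral hW f) P := (Lp.aestronglyMeasurable _).aemeasurable
  have := Measure.isProbabilityMeasure_map hm
  refine Measure.ext_of_charFun (funext fun r => ?_)
  rw [charFun_gaussianReal, charFun_apply_real, integral_map hm (by fun_prop)]
  -- By linearity, frequency `r` for `f` is frequency 1 for `r • f`.
  have h := integral_cexp_wienerIntegral hW (r • f)
  rw [map_smul, norm_smul, mul_pow, Real.norm_eq_abs, sq_abs] at h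
  have h2 : ∫ ω, Complex.exp (r * wienerIntegral hW f ω * Complex.I) ∂P
      = ∫ ω, Complex.exp ((r • wienerIntegral hW f : Lp ℝ 2 P) ω * Complex.I) ∂P := by
    refine integral_congr_ae ?_
    filter_upwards [Lp.coeFn_smul r (wienerIntegral hW f)] with ω hω
    rw [hω]
    simp
  rw [h2, h]
  congr 1
  rw [Real.coe_toNNReal _ (sq_nonneg _)]
  push_cast
  ring

theorem integral_wienerIntegral [IsProbabilityMeasure P] (hW : IsBrownianOn P W) (f : L2Icc T) :
    ∫ ω, wienerIntegral hW f ω ∂P = 0 := by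
  have h := integral_id_gaussianReal (μ := 0) (v := (‖f‖ ^ 2).toNNReal)
  rwa [← map_wienerIntegral hW f,
    integral_map (Lp.aestronglyMeasurable _).aemeasurable (by fun_prop)] at h

theorem sum_smul_wienerIntegral_ae_eq {ι : Type*} (hW : IsBrownianOn P W) (s : Finset ι)
    (a : ι → ℝ) (f : ι → L2Icc T) :
    wienerIntegral hW (∑ i ∈ s, a i • f i) =ᵐ[P]
      fun ω => ∑ i ∈ s, a i * wienerIntegral hW (f i) ω := by
  classical
  induction s using Finset.induction_on with
  | empty =>
    rw [Finset.sum_empty, map_zero]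
    exact Lp.coeFn_zero ℝ 2 P
  | insert t s ht ih =>
    rw [Finset.sum_insert ht, map_add, map_smul]
    filter_upwards [ih, Lp.coeFn_add (a t • wienerIntegral hW (f t))
      (wienerIntegral hW (∑ i ∈ s, a i • f i)), Lp.coeFn_smul (a t) (wienerIntegral hW (f t))]
      with ω h1 h2 h3
    rw [h2, Pi.add_apply, h1, h3, Pi.smul_apply, Finset.sum_insert ht, smul_eq_mul]

/-- The Wiener integrals of all square integrable functions form a Gaussian process. -/
theorem isGaussianProcess_wienerIntegral [IsProbabilityMeasure P] (hW : IsBrownianOn P W) :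
    IsGaussianProcess (fun (f : L2Icc T) ω => wienerIntegral hW f ω) P where
  hasGaussianLaw s := by
    classical
    have hm : ∀ f, AEMeasurable (wienerIntegral hW f) P :=
      fun f => (Lp.aestronglyMeasurable _).aemeasurable
    have hms : AEMeasurable (fun ω => s.restrict (fun f => wienerIntegral hW f ω)) P :=
      aemeasurable_pi_iff.2 fun f => hm f
    -- Cramér–Wold: a linear functional of finitely many Wiener integrals is again a Wiener
    -- integral, that of the combined integrand.
    refine ⟨isGaussian_of_map_eq_gaussianReal fun L =>
      ⟨0, (‖∑ f : s, L (Pi.single f 1) • (f : L2Icc T)‖ ^ 2).toNNReal, ?_⟩⟩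
    rw [AEMeasurable.map_map_of_aemeasurable (by fun_prop) hms, ← map_wienerIntegral hW]
    refine Measure.map_congr ?_
    filter_upwards [sum_smul_wienerIntegral_ae_eq hW Finset.univ
      (fun f : s => L (Pi.single f 1)) (fun f => (f : L2Icc T))] with ω h
    have hL := L.toLinearMap.pi_apply_eq_sum_univ (s.restrict fun f => wienerIntegral hW f ω)
    rw [h, Function.comp_apply]
    refine hL.trans (Finset.sum_congr rfl fun i _ => ?_)
    have hi : (fun j => if i = j then (1 : ℝ) else 0) = Pi.single i 1 := by
      ext j
      simp [Pi.single_apply, eq_comm]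
    rw [smul_eq_mul, mul_comm, hi]
    rfl

end WienerLaw

/-! ### The Fredholm system as an orthogonal projection -/

section Fredholm

variable {T : ℝ} {K : Set.Icc (0 : ℝ) T → Set.Icc (0 : ℝ) T → ℝ}

theorem inner_toLp_eq_integral (hKt : ∀ t, MemLp (K t) 2 (leb T)) (f : L2Icc T)
    (u : Set.Icc (0 : ℝ) T) :
    inner ℝ f ((hKt u).toLp (K u)) = ∫ s, f s * K u s ∂(leb T) := by
  rw [L2.inner_def]
  refine integral_congr_ae ?_
  filter_upwards [(hKt u).coeFn_toLp] with s hs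
  rw [hs]
  exact mul_comm _ _

theorem inner_toLp_toLp_eq_integral (hKt : ∀ t, MemLp (K t) 2 (leb T))
    (t u : Set.Icc (0 : ℝ) T) :
    inner ℝ ((hKt t).toLp (K t)) ((hKt u).toLp (K u)) = ∫ s, K t s * K u s ∂(leb T) := by
  rw [inner_toLp_eq_integral]
  refine integral_congr_ae ?_
  filter_upwards [(hKt t).coeFn_toLp] with s hs
  rw [hs]

theorem inner_eq_integral_mul (f g : L2Icc T) :
    inner ℝ f g = ∫ s, f s * g s ∂(leb T) := by
  rw [L2.inner_def]
  exact integral_congr_ae (.of_forall fun s => mul_comm _ _)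

/-- The closed span in `L²([0, T])` of the kernel sections `K(u, ·)`, `u ∈ Δ`. -/
noncomputable def kernelSpan (hKt : ∀ t, MemLp (K t) 2 (leb T)) (Δ : Set (Set.Icc (0 : ℝ) T)) :
    Submodule ℝ (L2Icc T) :=
  (Submodule.span ℝ ((fun u => (hKt u).toLp (K u)) '' Δ)).topologicalClosure

instance (hKt : ∀ t, MemLp (K t) 2 (leb T)) (Δ : Set (Set.Icc (0 : ℝ) T)) :
    CompleteSpace (kernelSpan hKt Δ) :=
  (Submodule.isClosed_topologicalClosure _).completeSpace_coe

theorem toLp_mem_kernelSpan (hKt : ∀ t, MemLp (K t) 2 (leb T)) {Δ : Set (Set.Icc (0 : ℝ) T)}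
    {u : Set.Icc (0 : ℝ) T} (hu : u ∈ Δ) : (hKt u).toLp (K u) ∈ kernelSpan hKt Δ :=
  Submodule.le_topologicalClosure _ (Submodule.subset_span ⟨u, hu, rfl⟩)

theorem mem_orthogonal_kernelSpan_iff (hKt : ∀ t, MemLp (K t) 2 (leb T))
    {Δ : Set (Set.Icc (0 : ℝ) T)} {g : L2Icc T} :
    g ∈ (kernelSpan hKt Δ)ᗮ ↔ ∀ u ∈ Δ, ∫ s, g s * K u s ∂(leb T) = 0 := by
  rw [kernelSpan, Submodule.orthogonal_closure, Submodule.mem_orthogonal']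
  constructor
  · intro h u hu
    rw [← inner_toLp_eq_integral hKt]
    exact h _ (Submodule.subset_span ⟨u, hu, rfl⟩)
  · intro h v hv
    induction hv using Submodule.span_induction with
    | mem x hx =>
      obtain ⟨u, hu, rfl⟩ := hx
      rw [inner_toLp_eq_integral]
      exact h u hu
    | zero => exact inner_zero_right _
    | add x y _ _ hx hy => rw [inner_add_right, hx, hy, add_zero]
    | smul a x _ hx => rw [inner_smul_right, hx, mul_zero]

/-- The solutions of the Fredholm problem are exactly the orthogonal projections of `K(t, ·)` onto
the closed span of the `K(u, ·)`, `u ∈ Δ`. -/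
theorem isFredholmSolution_iff (hKt : ∀ t, MemLp (K t) 2 (leb T))
    {Δ : Set (Set.Icc (0 : ℝ) T)} {t : Set.Icc (0 : ℝ) T} {f : L2Icc T} :
    IsFredholmSolution K Δ t f ↔ f = (kernelSpan hKt Δ).starProjection ((hKt t).toLp (K t)) := by
  have hsys : (∀ u ∈ Δ, ∫ s, f s * K u s ∂(leb T) = ∫ s, K t s * K u s ∂(leb T)) ↔
      (hKt t).toLp (K t) - f ∈ (kernelSpan hKt Δ)ᗮ := by
    rw [mem_orthogonal_kernelSpan_iff]
    refine forall₂_congr fun u _ => ?_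
    rw [← inner_toLp_eq_integral hKt, ← inner_toLp_eq_integral hKt,
      ← inner_toLp_toLp_eq_integral hKt, inner_sub_left, sub_eq_zero, eq_comm]
  have horth : (∀ g : L2Icc T, (∀ u ∈ Δ, ∫ s, g s * K u s ∂(leb T) = 0) →
      ∫ s, f s * g s ∂(leb T) = 0) ↔ f ∈ kernelSpan hKt Δ := by
    -- The double complement gives back the span because the span is closed.
    rw [← Submodule.orthogonal_orthogonal (kernelSpan hKt Δ), Submodule.mem_orthogonal']
    refine forall_congr' fun g => ?_
    rw [mem_orthogonal_kernelSpan_iff, inner_eq_integral_mul]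
  constructor
  · intro h
    exact (Submodule.eq_starProjection_of_mem_orthogonal (horth.1 h.orthogonal)
      (hsys.1 h.system)).symm
  · rintro rfl
    exact ⟨hsys.2 (Submodule.sub_starProjection_mem_orthogonal _),
      horth.2 (Submodule.starProjection_apply_mem _ _)⟩

end Fredholm

/-! ### Conditional expectation given the observations -/

section Prediction

variable {Ω : Type*} [MeasurableSpace Ω] {P : Measure Ω} {T : ℝ}
  {X W : Set.Icc (0 : ℝ) T → Ω → ℝ} {K : Set.Icc (0 : ℝ) T → Set.Icc (0 : ℝ) T → ℝ}

theorem sigmaOn_le (hX : ∀ t, Measurable (X t)) (Δ : Set (Set.Icc (0 : ℝ) T)) :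
    sigmaOn X Δ ≤ ‹MeasurableSpace Ω› :=
  iSup₂_le fun t _ => (hX t).comap_le

/-- Classes in `L²(Ω)` with a `sigmaOn X Δ`-measurable representative form a closed subspace; its
preimage under the integral is closed and contains each `K u`, `u ∈ Δ`. -/
theorem aestronglyMeasurable_wienerIntegral_of_mem_kernelSpan (hX : ∀ t, Measurable (X t))
    (hW : IsBrownianOn P W) (hKt : ∀ t, MemLp (K t) 2 (leb T))
    (hrep : ∀ t, X t =ᵐ[P] wienerIntegral hW ((hKt t).toLp (K t)))
    {Δ : Set (Set.Icc (0 : ℝ) T)} {f : L2Icc T} (hf : f ∈ kernelSpan hKt Δ) :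
    AEStronglyMeasurable[sigmaOn X Δ] (wienerIntegral hW f) P := by
  have hle : kernelSpan hKt Δ ≤
      (lpMeas ℝ ℝ (sigmaOn X Δ) 2 P).comap (wienerIntegral hW).toLinearMap := by
    refine Submodule.topologicalClosure_minimal _ (Submodule.span_le.2 ?_) ?_
    · rintro _ ⟨u, hu, rfl⟩
      refine (mem_lpMeas_iff_aestronglyMeasurable (𝕜 := ℝ)).2 (AEStronglyMeasurable.congr ?_ (hrep u))
      have hXu : Measurable[sigmaOn X Δ] (X u) :=
        (comap_measurable (X u)).mono (le_iSup₂_of_le u hu le_rfl) le_rfl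
      exact hXu.stronglyMeasurable.aestronglyMeasurable
    · exact (isClosed_aestronglyMeasurable (sigmaOn_le hX Δ)).preimage
        (wienerIntegral hW).continuous
  exact (mem_lpMeas_iff_aestronglyMeasurable (𝕜 := ℝ)).1 (hle hf)

theorem condExp_wienerIntegral_of_mem_orthogonal [IsProbabilityMeasure P]
    (hX : ∀ t, Measurable (X t))
    (hW : IsBrownianOn P W) (hKt : ∀ t, MemLp (K t) 2 (leb T))
    (hrep : ∀ t, X t =ᵐ[P] wienerIntegral hW ((hKt t).toLp (K t)))
    {Δ : Set (Set.Icc (0 : ℝ) T)} {g : L2Icc T} (hg : g ∈ (kernelSpan hKt Δ)ᗮ) :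
    P[wienerIntegral hW g | sigmaOn X Δ] =ᵐ[P] 0 := by
  have hgm : Measurable (wienerIntegral hW g) := (Lp.stronglyMeasurable _).measurable
  -- Independence needs the integral of `g` and the observations to be jointly Gaussian, so they are
  -- put in a single process indexed by `Unit ⊕ Δ`.
  have hgauss : IsGaussianProcess
      (Sum.elim (fun _ : Unit => (wienerIntegral hW g : Ω → ℝ)) (fun u : Δ => X u)) P := by
    refine ((isGaussianProcess_wienerIntegral hW).comp_right
      (Sum.elim (fun _ : Unit => g) (fun u : Δ => (hKt u).toLp (K u)))).congr ?_
    rintro (_ | u)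
    · exact .rfl
    · exact (hrep u).symm
  have hindep : IndepFun (fun ω (_ : Unit) => wienerIntegral hW g ω)
      (fun ω (u : Δ) => X u ω) P := by
    refine hgauss.indepFun_of_covariance_eq_zero (fun _ => hgm.aemeasurable)
      (fun u => (hX u).aemeasurable) fun _ u => ?_
    rw [covariance_eq_sub (Lp.memLp _) ((memLp_congr_ae (hrep u)).2 (Lp.memLp _)),
      integral_wienerIntegral, zero_mul, sub_zero]
    calc ∫ ω, (wienerIntegral hW g * X u : Ω → ℝ) ω ∂P
        = ∫ ω, wienerIntegral hW g ω * wienerIntegral hW ((hKt u).toLp (K u)) ω ∂P := by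
          refine integral_congr_ae ?_
          filter_upwards [hrep u] with ω h
          rw [Pi.mul_apply, h]
      _ = 0 := by
          rw [integral_mul_wienerIntegral]
          exact Submodule.inner_left_of_mem_orthogonal (toLp_mem_kernelSpan hKt u.2) hg
  have hsigma : sigmaOn X Δ = MeasurableSpace.comap (fun ω (u : Δ) => X u ω) inferInstance := by
    simp only [MeasurableSpace.pi, MeasurableSpace.comap_iSup, MeasurableSpace.comap_comp]
    exact iSup_subtype'
  have h := hindep.comp (measurable_pi_apply ()) measurable_id
  rw [IndepFun_iff_Indep, Function.id_comp, ← hsigma] at h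
  have hgm' : Measurable[MeasurableSpace.comap (wienerIntegral hW g) inferInstance]
      (wienerIntegral hW g) := comap_measurable _
  -- By independence the conditional expectation is the mean, which is zero.
  have hc := condExp_indep_eq hgm.comap_le (sigmaOn_le hX Δ) hgm'.stronglyMeasurable h
  rw [integral_wienerIntegral] at hc
  exact hc

theorem condExp_eq_wienerIntegral_starProjection [IsProbabilityMeasure P]
    (hX : ∀ t, Measurable (X t))
    (hW : IsBrownianOn P W) (hKt : ∀ t, MemLp (K t) 2 (leb T))
    (hrep : ∀ t, X t =ᵐ[P] wienerIntegral hW ((hKt t).toLp (K t)))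
    (Δ : Set (Set.Icc (0 : ℝ) T)) (t : Set.Icc (0 : ℝ) T) :
    P[X t | sigmaOn X Δ] =ᵐ[P]
      wienerIntegral hW ((kernelSpan hKt Δ).starProjection ((hKt t).toLp (K t))) := by
  set k := (hKt t).toLp (K t)
  set f := (kernelSpan hKt Δ).starProjection k
  have hint : ∀ g : L2Icc T, Integrable (wienerIntegral hW g) P :=
    fun g => (Lp.memLp _).integrable (by norm_num)
  have hdecomp : X t =ᵐ[P] (wienerIntegral hW f : Ω → ℝ) + wienerIntegral hW (k - f) := by
    have h : wienerIntegral hW k = wienerIntegral hW f + wienerIntegral hW (k - f) := by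
      rw [← map_add, add_sub_cancel]
    refine (hrep t).trans ?_
    rw [h]
    exact Lp.coeFn_add _ _
  filter_upwards [condExp_congr_ae (m := sigmaOn X Δ) hdecomp,
    condExp_add (hint f) (hint (k - f)) (sigmaOn X Δ),
    condExp_of_aestronglyMeasurable' (sigmaOn_le hX Δ)
      (aestronglyMeasurable_wienerIntegral_of_mem_kernelSpan hX hW hKt hrep
        (Submodule.starProjection_apply_mem _ k)) (hint f),
    condExp_wienerIntegral_of_mem_orthogonal hX hW hKt hrep
      (Submodule.sub_starProjection_mem_orthogonal (K := kernelSpan hKt Δ) k)] with ω h1 h2 h3 h4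
  rw [h1, h2, Pi.add_apply, h3, h4, Pi.zero_apply, add_zero]

end Prediction

theorem mainTheorem1 {Ω : Type*} [MeasurableSpace Ω] (P : Measure Ω) [IsProbabilityMeasure P]
    {T : ℝ} (hT : 0 < T)
    -- the process, the Brownian motion, and the kernel
    (X W : Set.Icc (0 : ℝ) T → Ω → ℝ) (K : Set.Icc (0 : ℝ) T → Set.Icc (0 : ℝ) T → ℝ)
    (hXmeas : ∀ t, Measurable (X t))
    (hXgauss : IsGaussianProcess X P)
    (hXcent : ∀ t, ∫ ω, X t ω ∂P = 0)
    (hXbdd : BddAbove (Set.range fun t => ∫ ω, (X t ω) ^ 2 ∂P))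
    (hW : IsBrownianOn P W)
    (hK : MemLp (Function.uncurry K) 2 ((leb T).prod (leb T)))
    (hKt : ∀ t, MemLp (K t) 2 (leb T))
    (hrep : ∀ t, X t =ᵐ[P] wienerIntegral hW ((hKt t).toLp (K t)))
    (hchaos : firstChaos P X = firstChaos P W)
    -- the observed set
    {n : ℕ} (tL tU : Fin n → Set.Icc (0 : ℝ) T)
    (hLU : ∀ k, tL k < tU k) (hUL : ∀ k l, k < l → tU k < tL l)
    (t : Set.Icc (0 : ℝ) T) (ht : t ∉ unionIcc tL tU) :
    ∃ f : L2Icc T,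
      IsFredholmSolution K (unionIcc tL tU) t f ∧
      (∀ f' : L2Icc T, IsFredholmSolution K (unionIcc tL tU) t f' → f' = f) ∧
      P[X t | sigmaOn X (unionIcc tL tU)] =ᵐ[P] wienerIntegral hW f := by
  exact ⟨_, (isFredholmSolution_iff hKt).2 rfl, fun _ h => (isFredholmSolution_iff hKt).1 h,
    condExp_eq_wienerIntegral_starProjection hXmeas hW hKt hrep _ t⟩
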